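/- Theorem 4.2. Let $B$ be a standard one-dimensional Brownian motion with continuous paths on a filtered probability space $(\Omega,\mathcal F,\{\mathcal F_t\}_{t\ge 0},\mathbb P)$ (adapted to $\{\mathcal F_t\}$, with increments after time $r$ independent of $\mathcal F_r$). Let $P_0>0$, $\sigma>0$ and $\mu\neq\frac12\sigma^2$ be real constants and let $$P_t=P_0\exp\bigl((\mu-\tfrac12\sigma^2)t+\sigma B_t\bigr)$$ be the geometric Brownian motion solving $dP_t=\mu P_t\,dt+\sigma P_t\,dB_t$. Put $\beta=\frac{-2\mu+\sigma^2}{\sigma^2}\ne 0$, $S_t=P_t^{\beta}$ and $s=S_0=P_0^\beta>0$. Let $u:[0,\infty)\to[0,\infty)$ be nondecreasing and absolutely continuous on every compact interval $[0,c]$, with $u(0)=0$, and let $w:[0,1]\to[0,1]$ be strictly increasing and absolutely continuous with $w(0)=0$ and $w(1)=1$. Let $\mathcal T$ be the set of all $\{\mathcal F_t\}$-stopping times $\tau$ with $\mathbb P(\tau<\infty)=1$, and for $\tau\in\mathcal T$ let $$J(\tau)=\int_0^\infty w\bigl(\mathbb P(u(S_\tau)>x)\bigr)\,dx\in[0,\infty].$$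 Suppose that $w$ is convex, and for $0<a\le s\le b$ put $$V(a,b)=\Bigl(1-w\bigl(\tfrac{s-a}{b-a}\bigr)\Bigr)u(a)+w\bigl(\tfrac{s-a}{b-a}\bigr)u(b),$$ where $V(s,s)=u(s)$. Then, in $[0,\infty]$, $$\sup_{\tau\in\mathcal T}J(\tau)=\sup_{0<a\le s\le b}V(a,b).$$ Moreover, if $(a^*,b^*)$ with $0<a^*\le s\le b^*$ attains the maximum of $V$ over all $(a,b)$ with $0<a\le s\le b$, then $$\tau_{(a^*,b^*)}=\begin{cases}\inf\{t\ge 0: S_t\notin(a^*,b^*)\},& a^*<b^*,\\ 0,& a^*=b^*,\end{cases}$$ belongs to $\mathcal T$ and $J(\tau_{(a^*,b^*)})=\sup_{\tau\in\mathcal T}J(\tau)$. -/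

import Mathlib

open MeasureTheory ProbabilityTheory
open scoped NNReal ENNReal

namespace DistortedStopping

/-- `B` is a standard one-dimensional Brownian motion on the filtered probability space
`(Ω, m, 𝓕, P)`: it is a Brownian motion (Gaussian finite-dimensional laws, started at `0`),
adapted to `𝓕`, with continuous paths, and its increments `B t - B r` are independent
of `𝓕 r`. -/
structure IsStandardBM {Ω : Type*} {m : MeasurableSpace Ω} (𝓕 : Filtration ℝ≥0 m)
    (P : Measure Ω) (B : ℝ≥0 → Ω → ℝ) : Prop where
  isBrownian : IsBrownianReal B P
  adapted : Adapted 𝓕 B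
  continuous_path : ∀ ω, Continuous fun t => B t ω
  indep_increment : ∀ r t : ℝ≥0, r ≤ t →
    Indep (MeasurableSpace.comap (fun ω => B t ω - B r ω) inferInstance) (𝓕 r) P

/-- Geometric Brownian motion with initial value `p₀`, drift `μ` and volatility `σ` driven by `B`,
that is, the solution `p₀ * exp ((μ - σ² / 2) t + σ B_t)` of `dP = μ P dt + σ P dB`, `P_0 = p₀`. -/
noncomputable def geometricBM {Ω : Type*} (p₀ μ σ : ℝ) (B : ℝ≥0 → Ω → ℝ) (t : ℝ≥0) (ω : Ω) : ℝ :=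
  p₀ * Real.exp ((μ - σ ^ 2 / 2) * (t : ℝ) + σ * B t ω)

/-- The exponent `β = (-2 μ + σ²) / σ²`. -/
noncomputable def scaleExponent (μ σ : ℝ) : ℝ := (-2 * μ + σ ^ 2) / σ ^ 2

/-- The process `S_t = P_t ^ β`, where `P` is the geometric Brownian motion. -/
noncomputable def scaledProcess {Ω : Type*} (p₀ μ σ : ℝ) (B : ℝ≥0 → Ω → ℝ)
    (t : ℝ≥0) (ω : Ω) : ℝ :=
  geometricBM p₀ μ σ B t ω ^ scaleExponent μ σ

/-- A payoff function on `[0, ∞)`: nondecreasing, absolutely continuous (on every compact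
subinterval of `[0, ∞)`), vanishing at `0`. Values on negative arguments are irrelevant. -/
structure IsPayoff (u : ℝ → ℝ) : Prop where
  monotoneOn : MonotoneOn u (Set.Ici 0)
  absolutelyContinuous : ∀ c : ℝ, 0 < c → AbsolutelyContinuousOnInterval u 0 c
  zero : u 0 = 0

/-- A probability distortion on `[0, 1]`: strictly increasing, absolutely continuous, with
`w 0 = 0` and `w 1 = 1`. Values outside `[0, 1]` are irrelevant. -/
structure IsDistortion (w : ℝ → ℝ) : Prop where
  strictMonoOn : StrictMonoOn w (Set.Icc 0 1)
  absolutelyContinuous : AbsolutelyContinuousOnInterval w 0 1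
  zero : w 0 = 0
  one : w 1 = 1

/-- The set of almost surely finite stopping times. -/
def admissibleTimes {Ω : Type*} {m : MeasurableSpace Ω} (𝓕 : Filtration ℝ≥0 m)
    (P : Measure Ω) : Set (Ω → WithTop ℝ≥0) :=
  {τ | IsStoppingTime 𝓕 τ ∧ ∀ᵐ ω ∂P, τ ω ≠ ⊤}

/-- The distorted mean payoff (Choquet expectation)
`J(τ) = ∫₀^∞ w (P (u (S_τ) > x)) dx ∈ [0, ∞]`. -/
noncomputable def distortedPayoff {Ω : Type*} {m : MeasurableSpace Ω} (P : Measure Ω)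
    (w u : ℝ → ℝ) (S : ℝ≥0 → Ω → ℝ) (τ : Ω → WithTop ℝ≥0) : ℝ≥0∞ :=
  ∫⁻ x in Set.Ioi (0 : ℝ), ENNReal.ofReal (w (P.real {ω | x < u (stoppedValue S τ ω)}))

/-- `τ` is an optimal stopping time: it is admissible and maximizes the distorted payoff. -/
def IsOptimalStopping {Ω : Type*} {m : MeasurableSpace Ω} (𝓕 : Filtration ℝ≥0 m)
    (P : Measure Ω) (w u : ℝ → ℝ) (S : ℝ≥0 → Ω → ℝ) (τ : Ω → WithTop ℝ≥0) : Prop :=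
  τ ∈ admissibleTimes 𝓕 P ∧ IsMaxOn (distortedPayoff P w u S) (admissibleTimes 𝓕 P) τ

/-- The pairs `(a, b)` with `0 < a ≤ s ≤ b`. -/
def thresholdPairs (s : ℝ) : Set (ℝ × ℝ) :=
  {q | 0 < q.1 ∧ q.1 ≤ s ∧ s ≤ q.2}

/-- `(1 - w ((s - a) / (b - a))) u(a) + w ((s - a) / (b - a)) u(b)` for `q = (a, b)`.
For `a = b` (hence `= s`) the weights are immaterial: the value is `u(s)`. -/
noncomputable def thresholdValue (w u : ℝ → ℝ) (s : ℝ) (q : ℝ × ℝ) : ℝ :=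
  (1 - w ((s - q.1) / (q.2 - q.1))) * u q.1 + w ((s - q.1) / (q.2 - q.1)) * u q.2

open Classical in
/-- The exit time `inf {t ≥ 0 : S_t ∉ (a, b)}` (`∞` if there is no such `t`) when `a < b`,
and the time `0` otherwise. -/
noncomputable def thresholdTime {Ω : Type*} (S : ℝ≥0 → Ω → ℝ) (a b : ℝ) : Ω → WithTop ℝ≥0 :=
  if a < b then hittingAfter S (Set.Ioo a b)ᶜ 0 else fun _ => 0

end DistortedStopping

/-! The exponent β removes the drift: S is the exponential martingale `s * exp (θ B_t - θ² t / 2)`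
with θ = βσ ≠ 0. The problem thereby becomes one about laws on (0, ∞) with prescribed mean.

Upper bound. By Fatou, E S_τ ≤ s for every admissible τ
(`IsStandardBM.lintegral_stoppedValue_expProcess_le`). If the mean is smaller than s, adding a
constant restores it without lowering the payoff. A nondegenerate law with mean s is a mixture of
two-point laws with mean s (`exists_two_point_mixture`), so the survival function of u(X) is the
mixture of the two-point survival functions. Jensen's inequality for the convex w at each level,
then Tonelli, bounds the Choquet integral by an average of values V(a, b), hence by their supremum
(`choquet_le_of_integral_eq`).

Attainment. The exit time of (a, b) is almost surely finite. The martingale stays in [a, b] until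
then, so its mean is exactly s (`IsStandardBM.lintegral_stoppedValue_exitTime`). The stopped law
lives on {a, b}, and the mean fixes its weights, giving the payoff V(a, b)
(`choquet_eq_thresholdValue`). Both the equality of suprema and the optimality of a maximizing pair
follow. -/

namespace DistortedStopping

/-! ### Choquet integrals and mixtures of two-point laws -/

section Choquet

open Set

/-- The Choquet integral of a two-point law. -/
lemma lintegral_distortion_two_point {w : ℝ → ℝ} (hw0 : w 0 = 0) (hw1 : w 1 = 1) {p A C : ℝ}
    (hp0 : 0 ≤ w p) (hp1 : w p ≤ 1) (hA : 0 ≤ A) (hAC : A ≤ C) :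
    ∫⁻ t in Ioi (0 : ℝ), ENNReal.ofReal
        (w ((1 - p) * (Iio A).indicator 1 t + p * (Iio C).indicator 1 t)) =
      ENNReal.ofReal ((1 - w p) * A + w p * C) := by
  -- The argument of `w` takes only the values 1, p and 0, so `w 0 = 0` and `w 1 = 1` let `w` pass
  -- through the indicators.
  have key : ∀ t : ℝ, ENNReal.ofReal
        (w ((1 - p) * (Iio A).indicator 1 t + p * (Iio C).indicator 1 t)) =
      (Iio A).indicator (fun _ => ENNReal.ofReal (1 - w p)) t +
        (Iio C).indicator (fun _ => ENNReal.ofReal (w p)) t := by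
    intro t
    by_cases h1 : t < A
    · have h2 : t < C := h1.trans_le hAC
      simp only [mem_Iio, h1, h2, indicator_of_mem, Pi.one_apply]
      rw [← ENNReal.ofReal_add (by linarith) hp0]
      congr 1
      ring_nf
      exact hw1
    · by_cases h2 : t < C <;> simp [h1, h2, hw0]
  simp_rw [key]
  have hvol : ∀ D : ℝ, (volume.restrict (Ioi (0 : ℝ))) (Iio D) = ENNReal.ofReal D := by
    intro D
    rw [Measure.restrict_apply measurableSet_Iio, inter_comm, Ioi_inter_Iio, Real.volume_Ioo,
      sub_zero]
  rw [lintegral_add_left (measurable_const.indicator measurableSet_Iio),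
    lintegral_indicator_const measurableSet_Iio, lintegral_indicator_const measurableSet_Iio,
    hvol, hvol, ← ENNReal.ofReal_mul (by linarith), ← ENNReal.ofReal_mul hp0,
    ← ENNReal.ofReal_add]
  · exact mul_nonneg (by linarith) hA
  · exact mul_nonneg hp0 (hA.trans hAC)

/-- The weight of the upper point in the law on two points `z.1 ≤ s < z.2` with mean `s`. -/
noncomputable def upperWeight (s : ℝ) (z : ℝ × ℝ) : ℝ := (s - z.1) / (z.2 - z.1)

lemma measurable_upperWeight (s : ℝ) : Measurable (upperWeight s) := by
  unfold upperWeight; fun_prop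

lemma upperWeight_nonneg {s : ℝ} {z : ℝ × ℝ} (h1 : z.1 ≤ s) (h2 : s ≤ z.2) :
    0 ≤ upperWeight s z := div_nonneg (by linarith) (by linarith)

lemma upperWeight_le_one {s : ℝ} {z : ℝ × ℝ} (h1 : z.1 ≤ s) (h2 : s ≤ z.2) :
    upperWeight s z ≤ 1 := div_le_one_of_le₀ (by linarith) (by linarith)

/-- A law on the line with mean `s`, not concentrated at `s`, is a mixture of two-point laws with
mean `s`. -/
lemma exists_two_point_mixture (ν : Measure ℝ) [IsProbabilityMeasure ν] {s : ℝ}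
    (hint : Integrable (fun x => x) ν) (hmean : ∫ x, x ∂ν = s) (hne : ¬ ∀ᵐ x ∂ν, x = s) :
    ∃ Q : Measure (ℝ × ℝ), IsProbabilityMeasure Q ∧ Q ≪ ν.prod ν ∧
      (∀ᵐ z ∂Q, z.1 ≤ s ∧ s < z.2) ∧
      ∀ g : ℝ → ℝ≥0∞, Measurable g →
        ∫⁻ z, (ENNReal.ofReal (1 - upperWeight s z) * g z.1 +
          ENNReal.ofReal (upperWeight s z) * g z.2) ∂Q = ∫⁻ x, g x ∂ν := by
  -- Since the mean is s, c is both E(X - s)⁺ and E(s - X)⁺. It is nonzero because the law is not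
  -- concentrated at s.
  set c : ℝ≥0∞ := ∫⁻ x, ENNReal.ofReal (x - s) ∂ν with hc
  have hint' : Integrable (fun x => x - s) ν := hint.sub (integrable_const s)
  have hct : c ≠ ∞ := by
    have := hint'.lintegral_lt_top
    exact this.ne
  have hct' : ∫⁻ x, ENNReal.ofReal (-(x - s)) ∂ν ≠ ∞ := (hint'.neg.lintegral_lt_top).ne
  have hcs : ∫⁻ x, ENNReal.ofReal (s - x) ∂ν = c := by
    have h0 : ∫ x, (x - s) ∂ν = 0 := by
      rw [integral_sub hint (integrable_const s), hmean]; simp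
    rw [integral_eq_lintegral_pos_part_sub_lintegral_neg_part hint', sub_eq_zero,
      ENNReal.toReal_eq_toReal_iff' hct hct'] at h0
    simp_rw [neg_sub] at h0
    exact h0.symm
  have hc0 : c ≠ 0 := by
    intro h0
    apply hne
    have e1 := (lintegral_eq_zero_iff (by fun_prop)).1 h0
    have e2 := (lintegral_eq_zero_iff (by fun_prop)).1 (hcs.trans h0)
    filter_upwards [e1, e2] with x h1 h2
    simp only [Pi.zero_apply, ENNReal.ofReal_eq_zero, sub_nonpos] at h1 h2
    exact le_antisymm h1 h2
  let T : Set (ℝ × ℝ) := Iic s ×ˢ Ioi s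
  have hT : MeasurableSet T := measurableSet_Iic.prod measurableSet_Ioi
  -- Mixing density (y - x)/c on x ≤ s < y. The factor y - x cancels the denominator of the
  -- two-point weights, leaving (y - s)/c and (s - x)/c. The double integrals then factor, and each
  -- contributes one factor c.
  let f : ℝ × ℝ → ℝ≥0∞ := T.indicator fun z => c⁻¹ * ENNReal.ofReal (z.2 - z.1)
  have hf : Measurable f := Measurable.indicator (by fun_prop) hT
  have hpm := measurable_upperWeight s
  have identity : ∀ g : ℝ → ℝ≥0∞, Measurable g →
        ∫⁻ z, (ENNReal.ofReal (1 - upperWeight s z) * g z.1 +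
          ENNReal.ofReal (upperWeight s z) * g z.2) ∂((ν.prod ν).withDensity f)
          = ∫⁻ x, g x ∂ν := by
    intro g hg
    rw [lintegral_withDensity_eq_lintegral_mul _ hf (by fun_prop)]
    let lo : ℝ → ℝ≥0∞ := (Iic s).indicator g
    let hi : ℝ → ℝ≥0∞ := (Ioi s).indicator g
    have hlo : Measurable lo := hg.indicator measurableSet_Iic
    have hhi : Measurable hi := hg.indicator measurableSet_Ioi
    have e : ∀ z : ℝ × ℝ, (f * fun z => ENNReal.ofReal (1 - upperWeight s z) * g z.1 +
          ENNReal.ofReal (upperWeight s z) * g z.2) z =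
        c⁻¹ * (lo z.1 * ENNReal.ofReal (z.2 - s) + ENNReal.ofReal (s - z.1) * hi z.2) := by
      rintro ⟨x, y⟩
      simp only [Pi.mul_apply, f, lo, hi, T]
      by_cases hx : x ≤ s
      · by_cases hy : s < y
        · have hxy : 0 < y - x := by linarith
          rw [indicator_of_mem (by exact ⟨hx, hy⟩), indicator_of_mem (by exact hx),
            indicator_of_mem (by exact hy), mul_assoc, mul_add, ← mul_assoc, ← mul_assoc,
            ← ENNReal.ofReal_mul hxy.le, ← ENNReal.ofReal_mul hxy.le]
          have h1 : (y - x) * upperWeight s (x, y) = s - x := by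
            simp only [upperWeight]; field_simp
          have h2 : (y - x) * (1 - upperWeight s (x, y)) = y - s := by linarith
          rw [h1, h2, mul_comm (g x)]
        · have h3 : ENNReal.ofReal (y - s) = 0 := ENNReal.ofReal_eq_zero.2 (by linarith)
          rw [indicator_of_notMem (by exact fun h => hy h.2),
            indicator_of_notMem (s := Ioi s) (by exact hy)]
          simp [h3]
      · have h3 : ENNReal.ofReal (s - x) = 0 := ENNReal.ofReal_eq_zero.2 (by linarith)
        rw [indicator_of_notMem (by exact fun h => hx h.1),
            indicator_of_notMem (s := Iic s) (by exact hx)]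
        simp [h3]
    simp_rw [e]
    rw [lintegral_const_mul _ (by fun_prop), lintegral_add_left (by fun_prop),
      lintegral_prod_mul (f := lo) (g := fun y => ENNReal.ofReal (y - s)) (by fun_prop)
        (by fun_prop),
      lintegral_prod_mul (f := fun x => ENNReal.ofReal (s - x)) (g := hi) (by fun_prop)
        (by fun_prop), hcs, ← hc, mul_comm _ c, ← mul_add, ← mul_assoc,
      ENNReal.inv_mul_cancel hc0 hct, one_mul, lintegral_indicator measurableSet_Iic,
      lintegral_indicator measurableSet_Ioi, ← compl_Iic, lintegral_add_compl _ measurableSet_Iic]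
  have hae : ∀ᵐ z ∂((ν.prod ν).withDensity f), z.1 ≤ s ∧ s < z.2 := by
    rw [ae_withDensity_iff hf]
    refine Filter.Eventually.of_forall fun z hz => ?_
    by_contra h
    exact hz (indicator_of_notMem (by exact h) _)
  refine ⟨(ν.prod ν).withDensity f, ⟨?_⟩, withDensity_absolutelyContinuous _ _, hae, identity⟩
  -- The total mass is the identity for g = 1, as the two weights add up to 1.
  have h1 := identity (fun _ => 1) measurable_const
  rw [lintegral_const, measure_univ, mul_one] at h1
  rw [← h1, ← lintegral_one]
  refine lintegral_congr_ae ?_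
  filter_upwards [hae] with z hz
  have hp0 := upperWeight_nonneg hz.1 hz.2.le
  have hp1 := upperWeight_le_one hz.1 hz.2.le
  rw [mul_one, mul_one, ← ENNReal.ofReal_add (by linarith) hp0]
  simp

/-- Among laws on `(0, ∞)` with mean `s` the Choquet integral for a convex distortion is dominated
by its values at two-point laws. -/
lemma choquet_le_of_integral_eq {w u : ℝ → ℝ} (hw0 : w 0 = 0) (hw1 : w 1 = 1) (hwm : Monotone w)
    (hconv : ConvexOn ℝ (Icc 0 1) w) (hwc : ContinuousOn w (Icc 0 1))
    (hum : Monotone u) (hu0 : u 0 = 0)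
    (ν : Measure ℝ) [IsProbabilityMeasure ν] {s : ℝ} (hpos : ∀ᵐ x ∂ν, 0 < x)
    (hint : Integrable (fun x => x) ν) (hmean : ∫ x, x ∂ν = s) {M : ℝ≥0∞}
    (hM : ∀ q ∈ thresholdPairs s, ENNReal.ofReal (thresholdValue w u s q) ≤ M) :
    ∫⁻ t in Ioi (0 : ℝ), ENNReal.ofReal (w (ν.real {x | t < u x})) ≤ M := by
  have hum' : Measurable u := hum.measurable
  have hwm' : Measurable w := hwm.measurable
  have hw01 : ∀ p, 0 ≤ p → p ≤ 1 → 0 ≤ w p ∧ w p ≤ 1 := fun p h0 h1 =>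
    ⟨hw0 ▸ hwm h0, hw1 ▸ hwm h1⟩
  by_cases hdeg : ∀ᵐ x ∂ν, x = s
  · have hs0 : 0 < s := by
      obtain ⟨x, h1, h2⟩ := (hpos.and hdeg).exists
      exact h2 ▸ h1
    have hus : 0 ≤ u s := hu0 ▸ hum hs0.le
    -- At (s, s) the weight is 0 / 0 = 0, so the threshold value is u(s).
    refine le_trans (le_of_eq ?_) (hM (s, s) ⟨hs0, le_rfl, le_rfl⟩)
    have h := lintegral_distortion_two_point hw0 hw1 (p := 0) (A := u s) (C := u s)
      hw0.ge (by simp [hw0]) hus le_rfl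
    simp only [thresholdValue, sub_self, div_zero]
    rw [← h]
    refine lintegral_congr fun t => ?_
    congr 2
    have h2 : ν.real {x | t < u x} = ν.real {_x | t < u s} := by
      refine measureReal_congr ?_
      filter_upwards [hdeg] with x hx
      change (t < u x) = (t < u s)
      rw [hx]
    rw [h2]
    by_cases h3 : t < u s <;> simp [h3]
  obtain ⟨Q, hQ, hac, hae, hid⟩ := exists_two_point_mixture ν hint hmean hdeg
  have hpos1 : ∀ᵐ z ∂Q, 0 < z.1 := hac (Measure.quasiMeasurePreserving_fst.ae hpos)
  have hpm := measurable_upperWeight s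
  -- Survival function at t of u(Y), with Y of the two-point law z. Its mean over `Q` is the
  -- survival function under `ν` (`hqmean`).
  let q : ℝ → ℝ × ℝ → ℝ := fun t z =>
    (1 - upperWeight s z) * (Iio (u z.1)).indicator 1 t
      + upperWeight s z * (Iio (u z.2)).indicator 1 t
  have hind : ∀ a t : ℝ, (Iio a).indicator (1 : ℝ → ℝ) t ∈ Icc (0 : ℝ) 1 := by
    intro a t
    by_cases h : t < a <;> simp [h]
  have hqmem : ∀ t, ∀ᵐ z ∂Q, q t z ∈ Icc (0 : ℝ) 1 := by
    intro t
    filter_upwards [hae] with z hz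
    have hp0 := upperWeight_nonneg hz.1 hz.2.le
    have hp1 := upperWeight_le_one hz.1 hz.2.le
    have h1 := hind (u z.1) t
    have h2 := hind (u z.2) t
    constructor
    · exact add_nonneg (mul_nonneg (by linarith) h1.1) (mul_nonneg hp0 h2.1)
    · have := mul_le_mul_of_nonneg_left h1.2 (by linarith : 0 ≤ 1 - upperWeight s z)
      have := mul_le_mul_of_nonneg_left h2.2 hp0
      simp only [q]; linarith
  have hqm : Measurable (Function.uncurry q) := by
    have m1 : ∀ φ : ℝ × ℝ → ℝ, Measurable φ →
        Measurable fun y : ℝ × (ℝ × ℝ) => (Iio (u (φ y.2))).indicator (1 : ℝ → ℝ) y.1 := by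
      intro φ hφ
      have : (fun y : ℝ × (ℝ × ℝ) => (Iio (u (φ y.2))).indicator (1 : ℝ → ℝ) y.1) =
          {y : ℝ × (ℝ × ℝ) | y.1 < u (φ y.2)}.indicator 1 := by
        ext y
        by_cases h : y.1 < u (φ y.2) <;> simp [h]
      rw [this]
      exact measurable_one.indicator (measurableSet_lt measurable_fst
        (hum'.comp (hφ.comp measurable_snd)))
    have m2 := m1 _ measurable_fst
    have m3 := m1 _ measurable_snd
    unfold q Function.uncurry
    fun_prop
  have hqt : ∀ t, Measurable (q t) := fun t => hqm.comp measurable_prodMk_left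
  have hqint : ∀ t, Integrable (q t) Q := fun t =>
    Integrable.of_mem_Icc 0 1 (hqt t).aemeasurable (hqmem t)
  have hwqmem : ∀ t, ∀ᵐ z ∂Q, w (q t z) ∈ Icc (0 : ℝ) 1 := fun t => by
    filter_upwards [hqmem t] with z hz using hw01 _ hz.1 hz.2
  have hwqint : ∀ t, Integrable (w ∘ q t) Q := fun t =>
    Integrable.of_mem_Icc 0 1 (hwm'.comp (hqt t)).aemeasurable (hwqmem t)
  have hqmean : ∀ t, ∫ z, q t z ∂Q = ν.real {x | t < u x} := by
    intro t
    rw [integral_eq_lintegral_of_nonneg_ae ((hqmem t).mono fun z hz => hz.1)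
      (hqt t).aestronglyMeasurable, measureReal_def]
    congr 1
    have hset : MeasurableSet {x | t < u x} := measurableSet_lt measurable_const hum'
    rw [← lintegral_indicator_one hset, ← hid _ (measurable_one.indicator hset)]
    refine lintegral_congr_ae ?_
    filter_upwards [hae] with z hz
    have hp0 := upperWeight_nonneg hz.1 hz.2.le
    have hp1 := upperWeight_le_one hz.1 hz.2.le
    rw [ENNReal.ofReal_add (mul_nonneg (by linarith) (hind _ _).1)
      (mul_nonneg hp0 (hind _ _).1), ENNReal.ofReal_mul (by linarith), ENNReal.ofReal_mul hp0]
    congr 2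
    · by_cases h : t < u z.1 <;> simp [h]
    · by_cases h : t < u z.2 <;> simp [h]
  calc ∫⁻ t in Ioi (0 : ℝ), ENNReal.ofReal (w (ν.real {x | t < u x}))
      ≤ ∫⁻ t in Ioi (0 : ℝ), ∫⁻ z, ENNReal.ofReal (w (q t z)) ∂Q := by
        refine lintegral_mono fun t => ?_
        have h := ofReal_integral_eq_lintegral_ofReal (hwqint t)
          ((hwqmem t).mono fun z hz => hz.1)
        simp only [Function.comp_apply] at h
        rw [← hqmean t, ← h]
        exact ENNReal.ofReal_le_ofReal
          (hconv.map_integral_le hwc isClosed_Icc (hqmem t) (hqint t) (hwqint t))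
    _ = ∫⁻ z, (∫⁻ t in Ioi (0 : ℝ), ENNReal.ofReal (w (q t z))) ∂Q :=
        lintegral_lintegral_swap (hwm'.comp hqm).ennreal_ofReal.aemeasurable
    _ ≤ ∫⁻ _, M ∂Q := by
        refine lintegral_mono_ae ?_
        filter_upwards [hae, hpos1] with z hz hz0
        have hp := hw01 _ (upperWeight_nonneg hz.1 hz.2.le) (upperWeight_le_one hz.1 hz.2.le)
        have h := lintegral_distortion_two_point hw0 hw1 hp.1 hp.2
          (A := u z.1) (C := u z.2) (hu0 ▸ hum hz0.le) (hum (hz.1.trans hz.2.le))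
        rw [h]
        exact hM z ⟨hz0, hz.1, hz.2.le⟩
    _ = M := by simp

/-- Version of `choquet_le_of_integral_eq` for a random variable with mean at most `s`. -/
lemma choquet_le_of_lintegral_le {w u : ℝ → ℝ} (hw0 : w 0 = 0) (hw1 : w 1 = 1) (hwm : Monotone w)
    (hconv : ConvexOn ℝ (Icc 0 1) w) (hwc : ContinuousOn w (Icc 0 1))
    (hum : Monotone u) (hu0 : u 0 = 0) {Ω : Type*} {m : MeasurableSpace Ω}
    (P : Measure Ω) [IsProbabilityMeasure P] {X : Ω → ℝ} (hX : Measurable X) (hpos : ∀ ω, 0 < X ω)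
    {s : ℝ} (hs : 0 ≤ s) (hmean : ∫⁻ ω, ENNReal.ofReal (X ω) ∂P ≤ ENNReal.ofReal s) {M : ℝ≥0∞}
    (hM : ∀ q ∈ thresholdPairs s, ENNReal.ofReal (thresholdValue w u s q) ≤ M) :
    ∫⁻ t in Ioi (0 : ℝ), ENNReal.ofReal (w (P.real {ω | t < u (X ω)})) ≤ M := by
  have hint : Integrable X P :=
    (lintegral_ofReal_ne_top_iff_integrable hX.aestronglyMeasurable
      (Filter.Eventually.of_forall fun ω => (hpos ω).le)).1
      (ne_top_of_le_ne_top ENNReal.ofReal_ne_top hmean)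
  have hle : ∫ ω, X ω ∂P ≤ s := by
    rw [← ofReal_integral_eq_lintegral_ofReal hint
      (Filter.Eventually.of_forall fun ω => (hpos ω).le)] at hmean
    exact (ENNReal.ofReal_le_ofReal_iff hs).1 hmean
  -- The missing mean: X + d has mean s and stays positive, and monotonicity of u and w makes its
  -- Choquet integral at least that of X.
  set d : ℝ := s - ∫ ω, X ω ∂P with hd
  have hd0 : 0 ≤ d := by linarith
  have hY : Measurable fun ω => X ω + d := hX.add_const d
  have : IsProbabilityMeasure (P.map fun ω => X ω + d) :=
    Measure.isProbabilityMeasure_map hY.aemeasurable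
  refine le_trans (lintegral_mono fun t => ?_) (choquet_le_of_integral_eq hw0 hw1 hwm hconv hwc
    hum hu0 (P.map fun ω => X ω + d) (s := s) ?_ ?_ ?_ hM)
  · refine ENNReal.ofReal_le_ofReal (hwm ?_)
    rw [map_measureReal_apply hY (measurableSet_lt measurable_const hum.measurable)]
    exact measureReal_mono fun ω (hω : t < u (X ω)) =>
      lt_of_lt_of_le hω (hum (le_add_of_nonneg_right hd0))
  · rw [ae_map_iff hY.aemeasurable measurableSet_Ioi]
    exact Filter.Eventually.of_forall fun ω => add_pos_of_pos_of_nonneg (hpos ω) hd0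
  · rw [integrable_map_measure (by fun_prop) hY.aemeasurable]
    exact hint.add (integrable_const d)
  · rw [integral_map hY.aemeasurable (by fun_prop),
      integral_add hint (integrable_const d), hd]
    simp

end Choquet

end DistortedStopping

namespace DistortedStopping

open Filter Set Topology

/-! ### Discretization and truncation of stopping times -/

section OptionalStopping

variable {Ω : Type*} {m : MeasurableSpace Ω} {𝓕 : Filtration ℝ≥0 m} {P : Measure Ω}

/-- The first point of the grid `(n + 1)⁻¹ ℕ` that is not smaller than `x`. -/
noncomputable def gridCeil (n : ℕ) (x : ℝ≥0) : ℝ≥0 := (⌈x * (n + 1)⌉₊ : ℝ≥0) / (n + 1)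

lemma measurable_gridCeil (n : ℕ) : Measurable (gridCeil n) := by
  unfold gridCeil; fun_prop

lemma le_gridCeil (n : ℕ) (x : ℝ≥0) : x ≤ gridCeil n x := by
  rw [gridCeil, le_div_iff₀ (by positivity)]
  exact Nat.le_ceil _

lemma gridCeil_le (n : ℕ) (x : ℝ≥0) : gridCeil n x ≤ x + 1 / (n + 1) := by
  rw [gridCeil, div_le_iff₀ (by positivity), add_mul, one_div,
    inv_mul_cancel₀ (by positivity)]
  exact (Nat.ceil_lt_add_one zero_le).le

lemma gridCeil_le_add_one (n : ℕ) (x : ℝ≥0) : gridCeil n x ≤ x + 1 := by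
  refine (gridCeil_le n x).trans (add_le_add_right ?_ x)
  rw [div_le_one (by positivity)]
  exact le_add_of_nonneg_left zero_le

lemma tendsto_gridCeil (x : ℝ≥0) : Tendsto (fun n => gridCeil n x) atTop (𝓝 x) := by
  refine tendsto_of_tendsto_of_tendsto_of_le_of_le tendsto_const_nhds ?_
    (fun n => le_gridCeil n x) (fun n => gridCeil_le n x)
  simpa using (tendsto_const_nhds (x := x)).add
    (tendsto_one_div_add_atTop_nhds_zero_nat (𝕜 := ℝ≥0))

/-- Optional stopping for a nonnegative process with the martingale property, at the
discretization of a bounded stopping time. -/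
lemma lintegral_gridCeil {M : ℝ≥0 → Ω → ℝ≥0∞}
    (hM : ∀ r t : ℝ≥0, r ≤ t → ∀ A, MeasurableSet[𝓕 r] A →
      ∫⁻ ω in A, M r ω ∂P = ∫⁻ ω in A, M t ω ∂P)
    {σ : Ω → ℝ≥0} (hσ : ∀ t, MeasurableSet[𝓕 t] {ω | σ ω ≤ t}) {T : ℝ≥0} (hT : ∀ ω, σ ω ≤ T)
    (n : ℕ) : ∫⁻ ω, M (gridCeil n (σ ω)) ω ∂P = ∫⁻ ω, M (T + 1) ω ∂P := by
  -- On `A k` the discretized time is k/(n + 1). Rounding up puts this event in the σ-algebra at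
  -- that time, so the martingale property applies on each piece.
  let A : ℕ → Set Ω := fun k => {ω | ⌈σ ω * (n + 1)⌉₊ = k}
  have hle : ∀ k : ℕ, {ω | ⌈σ ω * (n + 1)⌉₊ ≤ k} = {ω | σ ω ≤ (k : ℝ≥0) / (n + 1)} := by
    intro k
    ext ω
    simp only [mem_ofPred_eq]
    rw [Nat.ceil_le, le_div_iff₀ (by positivity)]
  have hAm : ∀ k : ℕ, MeasurableSet[𝓕 ((k : ℝ≥0) / (n + 1))] (A k) := by
    intro k
    have hA : A k = {ω | σ ω ≤ (k : ℝ≥0) / (n + 1)} \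
        ⋃ j ∈ Finset.range k, {ω | σ ω ≤ (j : ℝ≥0) / (n + 1)} := by
      ext ω
      simp_rw [← hle]
      simp only [A, mem_ofPred_eq, Set.mem_sdiff, mem_iUnion, Finset.mem_range, not_exists, not_le]
      constructor
      · rintro rfl
        exact ⟨le_rfl, fun j hj => hj⟩
      · rintro ⟨h1, h2⟩
        by_contra h3
        exact lt_irrefl _ (h2 _ (lt_of_le_of_ne h1 h3))
    rw [hA]
    refine (hσ _).diff (Finset.measurableSet_biUnion _ fun j hj => ?_)
    refine 𝓕.mono ?_ _ (hσ _)
    have : (j : ℝ≥0) ≤ k := by exact_mod_cast (Finset.mem_range.1 hj).le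
    gcongr
  have hAm' : ∀ k, MeasurableSet (A k) := fun k => 𝓕.le _ _ (hAm k)
  have hdisj : Pairwise (Function.onFun Disjoint A) := by
    intro i j hij
    refine Set.disjoint_left.2 fun ω (h1 : _ = i) (h2 : _ = j) => hij (h1.symm.trans h2)
  have hU : ⋃ k, A k = univ := eq_univ_of_forall fun ω => mem_iUnion.2 ⟨_, rfl⟩
  rw [← setLIntegral_univ, ← setLIntegral_univ (fun ω => M (T + 1) ω), ← hU,
    lintegral_iUnion hAm' hdisj, lintegral_iUnion hAm' hdisj]
  refine tsum_congr fun k => ?_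
  have h1 : ∫⁻ ω in A k, M (gridCeil n (σ ω)) ω ∂P =
      ∫⁻ ω in A k, M ((k : ℝ≥0) / (n + 1)) ω ∂P := by
    refine setLIntegral_congr_fun (hAm' k) fun ω (hω : _ = k) => ?_
    simp only [gridCeil, hω]
  rw [h1]
  -- Only a point of `A k` guarantees k/(n + 1) ≤ T + 1; the extra 1 covers the mesh of the grid.
  rcases (A k).eq_empty_or_nonempty with h | ⟨ω, hω⟩
  · simp [h]
  · refine hM _ _ ?_ _ (hAm k)
    have h2 : gridCeil n (σ ω) = (k : ℝ≥0) / (n + 1) := by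
      simp only [gridCeil, show ⌈σ ω * (n + 1)⌉₊ = k from hω]
    rw [← h2]
    exact (gridCeil_le_add_one n _).trans (add_le_add_left (hT ω) 1)

lemma coe_untopA {x : WithTop ℝ≥0} (hx : x ≠ ⊤) : (x.untopA : WithTop ℝ≥0) = x := by
  lift x to ℝ≥0 using hx
  rfl

/-- The truncation `τ ∧ T` of a random time, as a finite time. -/
noncomputable def truncTime (τ : Ω → WithTop ℝ≥0) (T : ℝ≥0) (ω : Ω) : ℝ≥0 := (min (τ ω) T).untopA

lemma truncTime_le (τ : Ω → WithTop ℝ≥0) (T : ℝ≥0) (ω : Ω) : truncTime τ T ω ≤ T :=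
  WithTop.untopA_le (min_le_right _ _)

lemma coe_truncTime (τ : Ω → WithTop ℝ≥0) (T : ℝ≥0) (ω : Ω) :
    (truncTime τ T ω : WithTop ℝ≥0) = min (τ ω) T :=
  coe_untopA (ne_top_of_le_ne_top WithTop.coe_ne_top (min_le_right _ _))

lemma measurableSet_truncTime_le {τ : Ω → WithTop ℝ≥0} (hτ : IsStoppingTime 𝓕 τ) (T t : ℝ≥0) :
    MeasurableSet[𝓕 t] {ω | truncTime τ T ω ≤ t} := by
  have h := hτ.min_const T t
  convert h using 2
  ext ω
  rw [← WithTop.coe_le_coe, coe_truncTime]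

lemma measurable_truncTime {τ : Ω → WithTop ℝ≥0} (hτ : IsStoppingTime 𝓕 τ) (T : ℝ≥0) :
    Measurable (truncTime τ T) :=
  measurable_of_Iic fun t => 𝓕.le t _ (measurableSet_truncTime_le hτ T t)

lemma truncTime_eq_of_le {τ : Ω → WithTop ℝ≥0} {ω : Ω} (hω : τ ω ≠ ⊤) {T : ℝ≥0}
    (hT : (τ ω).untopA ≤ T) : truncTime τ T ω = (τ ω).untopA := by
  rw [← WithTop.coe_inj, coe_truncTime, coe_untopA hω, min_eq_left]
  exact (WithTop.untopA_le_iff hω).1 hT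

end OptionalStopping

/-! ### Hitting times of closed sets by continuous paths -/

section HittingTime

variable {Ω : Type*} {m : MeasurableSpace Ω} {𝓕 : Filtration ℝ≥0 m} {β : Type*}
  [PseudoEMetricSpace β] {X : ℝ≥0 → Ω → β}

/-- The instants at which a continuous path lies in C form a closed set, so the infimum is attained.
-/
lemma mem_of_hittingAfter_ne_top {C : Set β} (hC : IsClosed C) (hX : ∀ ω, Continuous fun t => X t ω)
    {ω : Ω} (h : hittingAfter X C 0 ω ≠ ⊤) : X (hittingAfter X C 0 ω).untopA ω ∈ C := by
  have hex : ∃ j, 0 ≤ j ∧ X j ω ∈ C := by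
    by_contra hne
    exact h (by simp only [hittingAfter, if_neg hne])
  have hcl : IsClosed {i : ℝ≥0 | 0 ≤ i ∧ X i ω ∈ C} := by
    have : {i : ℝ≥0 | 0 ≤ i ∧ X i ω ∈ C} = (fun i => X i ω) ⁻¹' C := by ext i; simp
    rw [this]
    exact hC.preimage (hX ω)
  have hmem := hcl.csInf_mem hex (OrderBot.bddBelow _)
  simp only [hittingAfter, if_pos hex, WithTop.untopD_coe]
  exact hmem.2

/-- The hitting time of a closed set by a continuous adapted process is a stopping time. -/
lemma isStoppingTime_hittingAfter_isClosed [MeasurableSpace β] [BorelSpace β] {C : Set β}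
    (hC : IsClosed C) (hX : ∀ ω, Continuous fun t => X t ω) (hA : Adapted 𝓕 X) :
    IsStoppingTime 𝓕 (hittingAfter X C 0) := by
  intro t
  -- By compactness of [0, t], a continuous path meets C by time t iff its distance to C becomes
  -- arbitrarily small on a dense sequence of times cut off at t. This countable description uses
  -- only the past of t, so no right-continuity of the filtration is needed.
  have key : {ω | hittingAfter X C 0 ω ≤ t} =
      ⋂ n : ℕ, ⋃ k : ℕ, {ω | Metric.infEDist (X (min (TopologicalSpace.denseSeq ℝ≥0 k) t) ω) C
        < ((n : ℝ≥0∞) + 1)⁻¹} := by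
    ext ω
    simp only [mem_ofPred_eq, mem_iInter, mem_iUnion]
    have hc : Continuous fun r => Metric.infEDist (X (min r t) ω) C :=
      Metric.continuous_infEDist.comp ((hX ω).comp (by fun_prop))
    constructor
    · intro hle n
      have hne : hittingAfter X C 0 ω ≠ ⊤ := ne_top_of_le_ne_top WithTop.coe_ne_top hle
      have hmem := mem_of_hittingAfter_ne_top hC hX hne
      have hτ : (hittingAfter X C 0 ω).untopA ≤ t := WithTop.untopA_le hle
      have hopen : IsOpen {r | Metric.infEDist (X (min r t) ω) C < ((n : ℝ≥0∞) + 1)⁻¹} :=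
        isOpen_lt hc continuous_const
      obtain ⟨y, hy, k, rfl⟩ := (TopologicalSpace.denseRange_denseSeq ℝ≥0).inter_open_nonempty _
        hopen ⟨(hittingAfter X C 0 ω).untopA, by
          simp only [mem_ofPred_eq]
          rw [min_eq_left hτ, Metric.infEDist_zero_of_mem hmem]
          simp⟩
      exact ⟨k, hy⟩
    · intro h
      obtain ⟨r, -, hr⟩ := (isCompact_Icc (a := (0 : ℝ≥0)) (b := t)).exists_isMinOn
        ⟨0, left_mem_Icc.2 zero_le⟩ hc.continuousOn
      have hzero : Metric.infEDist (X (min r t) ω) C = 0 := by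
        by_contra hpos
        obtain ⟨n, hn⟩ := ENNReal.exists_inv_nat_lt hpos
        obtain ⟨k, hk⟩ := h n
        have h1 := hr (show min (TopologicalSpace.denseSeq ℝ≥0 k) t ∈ Icc 0 t from
          ⟨zero_le, min_le_right _ _⟩)
        simp only [mem_ofPred_eq, min_assoc, min_self] at h1
        refine absurd (h1.trans_lt hk) (not_lt.2 (le_trans ?_ hn.le))
        exact ENNReal.inv_le_inv.2 le_self_add
      have hmem : X (min r t) ω ∈ C := by
        rw [← hC.closure_eq]
        exact Metric.mem_closure_iff_infEDist_zero.2 hzero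
      exact (hittingAfter_le_of_mem zero_le hmem).trans (WithTop.coe_le_coe.2 (min_le_right _ _))
  rw [key]
  refine MeasurableSet.iInter fun n => MeasurableSet.iUnion fun k => ?_
  have h1 : Measurable[𝓕 t] (X (min (TopologicalSpace.denseSeq ℝ≥0 k) t)) :=
    (hA _).mono (𝓕.mono (min_le_right _ _)) le_rfl
  exact measurableSet_lt (Metric.continuous_infEDist.measurable.comp h1) measurable_const

end HittingTime

/-! ### The exponential martingale and optional stopping -/

section ExponentialMartingale

variable {Ω : Type*} {m : MeasurableSpace Ω} {𝓕 : Filtration ℝ≥0 m} {P : Measure Ω}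
  {B : ℝ≥0 → Ω → ℝ}

/-- The exponential martingale `c * exp (θ B_t - θ² t / 2)`. -/
noncomputable def expProcess (c θ : ℝ) (B : ℝ≥0 → Ω → ℝ) (t : ℝ≥0) (ω : Ω) : ℝ :=
  c * Real.exp (θ * B t ω - θ ^ 2 / 2 * t)

lemma expProcess_pos {c : ℝ} (hc : 0 < c) (θ : ℝ) (t : ℝ≥0) (ω : Ω) : 0 < expProcess c θ B t ω :=
  mul_pos hc (Real.exp_pos _)

lemma IsStandardBM.continuous_expProcess (hB : IsStandardBM 𝓕 P B) (c θ : ℝ) (ω : Ω) :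
    Continuous fun t => expProcess c θ B t ω := by
  have := hB.continuous_path ω
  unfold expProcess
  fun_prop

lemma IsStandardBM.adapted_expProcess (hB : IsStandardBM 𝓕 P B) (c θ : ℝ) :
    Adapted 𝓕 (expProcess c θ B) := by
  intro t
  have := hB.adapted t
  unfold expProcess
  exact (((this.const_mul θ).sub_const _).exp).const_mul c

lemma IsStandardBM.measurable_uncurry_expProcess (hB : IsStandardBM 𝓕 P B) (c θ : ℝ) :
    Measurable (Function.uncurry (expProcess c θ B)) :=
  measurable_uncurry_of_continuous_of_measurable (hB.continuous_expProcess c θ)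
    fun t => (hB.adapted_expProcess c θ t).mono (𝓕.le t) le_rfl

lemma IsStandardBM.measurable_expProcess_comp (hB : IsStandardBM 𝓕 P B) (c θ : ℝ)
    {σ : Ω → ℝ≥0} (hσ : Measurable σ) : Measurable fun ω => expProcess c θ B (σ ω) ω :=
  (hB.measurable_uncurry_expProcess c θ).comp (hσ.prodMk measurable_id)

lemma IsStandardBM.expProcess_zero (hB : IsStandardBM 𝓕 P B) (c θ : ℝ) :
    ∀ᵐ ω ∂P, expProcess c θ B 0 ω = c := by
  filter_upwards [hB.isBrownian.toIsPreBrownianReal.eval_zero_ae_eq_zero] with ω hω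
  simp [expProcess, hω]

/-- This is the Gaussian moment generating function: the increment has variance t - r. -/
lemma IsStandardBM.lintegral_exp_increment (hB : IsStandardBM 𝓕 P B) (θ : ℝ) {r t : ℝ≥0}
    (hrt : r ≤ t) :
    ∫⁻ ω, ENNReal.ofReal (Real.exp (θ * (B t ω - B r ω) - θ ^ 2 / 2 * (t - r))) ∂P = 1 := by
  have hlaw := hB.isBrownian.toIsPreBrownianReal.hasLaw_sub t r
  have hv : nndist t.1 r.1 = t - r := by
    ext
    change ((nndist (t : ℝ) (r : ℝ) : ℝ≥0) : ℝ) = _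
    rw [coe_nndist, Real.dist_eq, NNReal.coe_sub hrt, abs_of_nonneg]
    exact sub_nonneg.2 (by exact_mod_cast hrt)
  rw [hv] at hlaw
  have h1 := hlaw.lintegral_comp
    (f := fun x => ENNReal.ofReal (Real.exp (θ * x - θ ^ 2 / 2 * (t - r)))) (by fun_prop)
  simp only [Pi.sub_apply] at h1
  rw [h1]
  have h2 : ∀ x : ℝ, ENNReal.ofReal (Real.exp (θ * x - θ ^ 2 / 2 * (t - r))) =
      ENNReal.ofReal (Real.exp (- (θ ^ 2 / 2 * (t - r)))) * ENNReal.ofReal (Real.exp (θ * x)) := by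
    intro x
    rw [← ENNReal.ofReal_mul (Real.exp_pos _).le, ← Real.exp_add]
    ring_nf
  simp_rw [h2]
  rw [lintegral_const_mul _ (by fun_prop), ← ofReal_integral_eq_lintegral_ofReal
    (integrable_exp_mul_gaussianReal θ) (ae_of_all _ fun x => (Real.exp_pos _).le)]
  have h3 : ∫ x, Real.exp (θ * x) ∂(gaussianReal 0 (t - r)) =
      Real.exp (θ ^ 2 / 2 * (t - r)) := by
    have := congrFun (mgf_fun_id_gaussianReal (μ := 0) (v := t - r)) θ
    rw [mgf] at this
    rw [this, NNReal.coe_sub hrt]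
    ring_nf
  rw [h3, ← ENNReal.ofReal_mul (Real.exp_pos _).le, ← Real.exp_add]
  simp

/-- The value at t is the value at r times a factor independent of `𝓕 r` with mean 1. This is the
martingale property in terms of `∫⁻`, free of integrability conditions. -/
lemma IsStandardBM.setLIntegral_expProcess (hB : IsStandardBM 𝓕 P B) {c : ℝ} (hc : 0 ≤ c) (θ : ℝ)
    {r t : ℝ≥0} (hrt : r ≤ t) {A : Set Ω} (hA : MeasurableSet[𝓕 r] A) :
    ∫⁻ ω in A, ENNReal.ofReal (expProcess c θ B r ω) ∂P =
      ∫⁻ ω in A, ENNReal.ofReal (expProcess c θ B t ω) ∂P := by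
  have hA' := 𝓕.le r _ hA
  rw [← lintegral_indicator hA', ← lintegral_indicator hA']
  have hBm : ∀ t, Measurable (B t) := fun t => (hB.adapted t).mono (𝓕.le t) le_rfl
  have hf : Measurable[𝓕 r] (A.indicator fun ω => ENNReal.ofReal (expProcess c θ B r ω)) :=
    (hB.adapted_expProcess c θ r).ennreal_ofReal.indicator hA
  have hinc : Measurable[MeasurableSpace.comap (fun ω => B t ω - B r ω) inferInstance]
      fun ω => ENNReal.ofReal (Real.exp (θ * (B t ω - B r ω) - θ ^ 2 / 2 * (t - r))) := by
    have h1 : Measurable fun x : ℝ =>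
      ENNReal.ofReal (Real.exp (θ * x - θ ^ 2 / 2 * (t - r))) := by fun_prop
    exact h1.comp (comap_measurable _)
  have hcle : MeasurableSpace.comap (fun ω => B t ω - B r ω) inferInstance ≤ m :=
    ((hBm t).sub (hBm r)).comap_le
  have hprod := lintegral_mul_eq_lintegral_mul_lintegral_of_independent_measurableSpace
    (𝓕.le r) hcle (hB.indep_increment r t hrt).symm hf hinc
  rw [hB.lintegral_exp_increment θ hrt, mul_one] at hprod
  rw [← hprod]
  refine lintegral_congr fun ω => ?_
  by_cases hω : ω ∈ A
  · rw [indicator_of_mem hω, indicator_of_mem hω, ← ENNReal.ofReal_mul]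
    · congr 1
      rw [expProcess, expProcess, mul_assoc, ← Real.exp_add]
      ring_nf
    · exact mul_nonneg hc (Real.exp_pos _).le
  · rw [indicator_of_notMem hω, indicator_of_notMem hω, zero_mul]

lemma IsStandardBM.lintegral_expProcess [IsProbabilityMeasure P] (hB : IsStandardBM 𝓕 P B) {c : ℝ} (hc : 0 ≤ c) (θ : ℝ)
    (t : ℝ≥0) : ∫⁻ ω, ENNReal.ofReal (expProcess c θ B t ω) ∂P = ENNReal.ofReal c := by
  have h := hB.setLIntegral_expProcess hc θ (zero_le (a := t)) (A := univ) MeasurableSet.univ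
  rw [setLIntegral_univ, setLIntegral_univ] at h
  rw [← h, lintegral_congr_ae (g := fun _ => ENNReal.ofReal c)]
  · simp
  · filter_upwards [hB.expProcess_zero c θ] with ω hω
    rw [hω]

lemma IsStandardBM.lintegral_expProcess_gridCeil [IsProbabilityMeasure P] (hB : IsStandardBM 𝓕 P B) {c : ℝ} (hc : 0 ≤ c)
    (θ : ℝ) {σ : Ω → ℝ≥0} (hσ : ∀ t, MeasurableSet[𝓕 t] {ω | σ ω ≤ t}) {T : ℝ≥0}
    (hT : ∀ ω, σ ω ≤ T) (n : ℕ) :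
    ∫⁻ ω, ENNReal.ofReal (expProcess c θ B (gridCeil n (σ ω)) ω) ∂P = ENNReal.ofReal c := by
  rw [lintegral_gridCeil (M := fun t ω => ENNReal.ofReal (expProcess c θ B t ω))
    (fun r t hrt A hA => hB.setLIntegral_expProcess hc θ hrt hA) hσ hT,
    hB.lintegral_expProcess hc]

/-- The exponential martingale is a supermartingale up to an almost surely finite stopping time. -/
lemma IsStandardBM.lintegral_stoppedValue_expProcess_le [IsProbabilityMeasure P] (hB : IsStandardBM 𝓕 P B) {c : ℝ}
    (hc : 0 ≤ c) (θ : ℝ) {τ : Ω → WithTop ℝ≥0} (hτ : τ ∈ admissibleTimes 𝓕 P) :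
    ∫⁻ ω, ENNReal.ofReal (stoppedValue (expProcess c θ B) τ ω) ∂P ≤ ENNReal.ofReal c := by
  -- Fatou along the grid roundings of τ ∧ n. Each has mean c, and path continuity gives convergence
  -- once n exceeds τ.
  let f : ℕ → Ω → ℝ≥0∞ := fun n ω =>
    ENNReal.ofReal (expProcess c θ B (gridCeil n (truncTime τ n ω)) ω)
  have hf : ∀ n, Measurable (f n) := fun n => (hB.measurable_expProcess_comp c θ
    ((measurable_gridCeil n).comp (measurable_truncTime hτ.1 n))).ennreal_ofReal
  have hlim : ∀ᵐ ω ∂P, liminf (fun n => f n ω) atTop =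
      ENNReal.ofReal (stoppedValue (expProcess c θ B) τ ω) := by
    filter_upwards [hτ.2] with ω hω
    refine Tendsto.liminf_eq (ENNReal.tendsto_ofReal ?_)
    refine ((hB.continuous_expProcess c θ ω).tendsto _).comp ?_
    refine (tendsto_gridCeil (τ ω).untopA).congr' ?_
    obtain ⟨N, hN⟩ := exists_nat_ge (τ ω).untopA
    filter_upwards [eventually_ge_atTop N] with n hn
    rw [truncTime_eq_of_le hω (hN.trans (by exact_mod_cast hn))]
  calc ∫⁻ ω, ENNReal.ofReal (stoppedValue (expProcess c θ B) τ ω) ∂P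
      = ∫⁻ ω, liminf (fun n => f n ω) atTop ∂P :=
        lintegral_congr_ae (hlim.mono fun ω h => h.symm)
    _ ≤ liminf (fun n => ∫⁻ ω, f n ω ∂P) atTop := lintegral_liminf_le hf
    _ = ENNReal.ofReal c := by
        simp_rw [f, fun n : ℕ => hB.lintegral_expProcess_gridCeil hc θ
          (measurableSet_truncTime_le hτ.1 n) (truncTime_le τ n) n]
        simp

/-- Optional stopping for the exponential martingale at a bounded stopping time. -/
lemma IsStandardBM.le_lintegral_expProcess_of_bounded [IsProbabilityMeasure P] (hB : IsStandardBM 𝓕 P B) {c : ℝ}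
    (hc : 0 ≤ c) (θ : ℝ) {σ : Ω → ℝ≥0} (hσ : ∀ t, MeasurableSet[𝓕 t] {ω | σ ω ≤ t}) {T : ℝ≥0}
    (hT : ∀ ω, σ ω ≤ T) :
    ENNReal.ofReal c ≤ ∫⁻ ω, ENNReal.ofReal (expProcess c θ B (σ ω) ω) ∂P := by
  have hσm : Measurable σ := measurable_of_Iic fun t => 𝓕.le t _ (hσ t)
  let f : ℕ → Ω → ℝ≥0∞ := fun n ω => ENNReal.ofReal (expProcess c θ B (gridCeil n (σ ω)) ω)
  let g : Ω → ℝ≥0∞ := fun ω => ENNReal.ofReal (expProcess c θ B (σ ω) ω)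
  have hf : ∀ n, Measurable (f n) := fun n => (hB.measurable_expProcess_comp c θ
    ((measurable_gridCeil n).comp hσm)).ennreal_ofReal
  have hlim : ∀ ω, Tendsto (fun n => f n ω) atTop (𝓝 (g ω)) := fun ω =>
    ENNReal.tendsto_ofReal (((hB.continuous_expProcess c θ ω).tendsto _).comp
      (tendsto_gridCeil (σ ω)))
  -- Uniform second-moment bound: the square of the martingale is exp(θ² t) times the exponential
  -- martingale with parameters c² and 2θ, and t ≤ T + 1 on the grid.
  set D : ℝ≥0∞ := ENNReal.ofReal (Real.exp (θ ^ 2 * (T + 1))) * ENNReal.ofReal (c ^ 2) with hD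
  have hDt : D ≠ ∞ := ENNReal.mul_ne_top ENNReal.ofReal_ne_top ENNReal.ofReal_ne_top
  have hsq : ∀ n, ∫⁻ ω, f n ω * f n ω ∂P ≤ D := by
    intro n
    rw [hD, ← hB.lintegral_expProcess_gridCeil (sq_nonneg c) (2 * θ) hσ hT n,
      ← lintegral_const_mul' _ _ ENNReal.ofReal_ne_top]
    refine lintegral_mono fun ω => ?_
    simp only [f]
    rw [← ENNReal.ofReal_mul (by exact mul_nonneg hc (Real.exp_pos _).le),
      ← ENNReal.ofReal_mul (Real.exp_pos _).le]
    refine ENNReal.ofReal_le_ofReal ?_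
    set t := gridCeil n (σ ω) with ht
    have htT : (t : ℝ) ≤ T + 1 := by
      exact_mod_cast (gridCeil_le_add_one n _).trans (add_le_add_left (hT ω) 1)
    have e1 : expProcess c θ B t ω * expProcess c θ B t ω =
        Real.exp (θ ^ 2 * t) * expProcess (c ^ 2) (2 * θ) B t ω := by
      simp only [expProcess]
      rw [mul_mul_mul_comm, ← Real.exp_add, mul_left_comm, ← Real.exp_add]
      ring_nf
    rw [e1]
    refine mul_le_mul_of_nonneg_right ?_ (mul_nonneg (sq_nonneg c) (Real.exp_pos _).le)
    exact Real.exp_le_exp.2 (mul_le_mul_of_nonneg_left htT (sq_nonneg θ))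
  -- Uniform integrability by hand: x ≤ min(x, k) + x²/k. The truncated part converges by dominated
  -- convergence and the remainder is at most D/k. The level k = K + 1 is never zero.
  have hmin : ∀ K : ℕ, ENNReal.ofReal c ≤
      ∫⁻ ω, g ω ∂P + D * ((K + 1 : ℕ) : ℝ≥0∞)⁻¹ := by
    intro K
    set k : ℝ≥0∞ := ((K + 1 : ℕ) : ℝ≥0∞) with hk
    have hk0 : k ≠ 0 := by simp [hk]
    have hkt : k ≠ ∞ := ENNReal.natCast_ne_top _
    have hpt : ∀ x : ℝ≥0∞, x ≤ min x k + x * x * k⁻¹ := by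
      intro x
      rcases le_total x k with h | h
      · rw [min_eq_left h]; exact le_self_add
      · refine le_add_of_le_right ?_
        rw [← div_eq_mul_inv, ENNReal.le_div_iff_mul_le (Or.inl hk0) (Or.inl hkt)]
        exact mul_le_mul_right h x
    have hstep : ∀ n, ENNReal.ofReal c ≤ ∫⁻ ω, min (f n ω) k ∂P + D * k⁻¹ := by
      intro n
      calc ENNReal.ofReal c = ∫⁻ ω, f n ω ∂P :=
            (hB.lintegral_expProcess_gridCeil hc θ hσ hT n).symm
        _ ≤ ∫⁻ ω, (min (f n ω) k + f n ω * f n ω * k⁻¹) ∂P := lintegral_mono fun ω => hpt _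
        _ = ∫⁻ ω, min (f n ω) k ∂P + (∫⁻ ω, f n ω * f n ω ∂P) * k⁻¹ := by
            rw [lintegral_add_left ((hf n).min measurable_const)]
            rw [lintegral_mul_const (r := k⁻¹) (f := fun ω => f n ω * f n ω) (by fun_prop)]
        _ ≤ _ := by gcongr; exact hsq n
    have hdct : Tendsto (fun n => ∫⁻ ω, min (f n ω) k ∂P) atTop (𝓝 (∫⁻ ω, min (g ω) k ∂P)) :=
      tendsto_lintegral_of_dominated_convergence (fun _ => k)
        (fun n => (hf n).min measurable_const) (fun n => ae_of_all _ fun ω => min_le_right _ _)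
        (by simpa using hkt) (ae_of_all _ fun ω => (hlim ω).min tendsto_const_nhds)
    refine (ge_of_tendsto' (hdct.add_const _) hstep).trans ?_
    gcongr
    exact min_le_left _ _
  have hK : Tendsto (fun K : ℕ => ∫⁻ ω, g ω ∂P + D * ((K + 1 : ℕ) : ℝ≥0∞)⁻¹) atTop
      (𝓝 (∫⁻ ω, g ω ∂P + 0)) := by
    refine Tendsto.const_add _ ?_
    have h0 := ENNReal.Tendsto.const_mul (a := D)
      ((tendsto_add_atTop_iff_nat 1).2 ENNReal.tendsto_inv_nat_nhds_zero) (Or.inr hDt)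
    rwa [mul_zero] at h0
  rw [add_zero] at hK
  exact ge_of_tendsto' hK hmin

end ExponentialMartingale

end DistortedStopping

namespace DistortedStopping

open Filter Set Topology

/-! ### Exit from an interval -/

section ExitTime

/-- Strictly before the exit the path is in (a, b), and continuity carries this to [a, b] at t. Time
0 is separate because no earlier times exist. -/
lemma mem_Icc_of_le_hittingAfter {Ω : Type*} {X : ℝ≥0 → Ω → ℝ} {a b : ℝ} {ω : Ω}
    (hX : Continuous fun t => X t ω) (h0 : X 0 ω ∈ Icc a b) {t : ℝ≥0}
    (ht : (t : WithTop ℝ≥0) ≤ hittingAfter X (Ioo a b)ᶜ 0 ω) : X t ω ∈ Icc a b := by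
  rcases eq_or_ne t 0 with rfl | hne
  · exact h0
  have hsub : Iio t ⊆ (fun r => X r ω) ⁻¹' Icc a b := by
    intro r hr
    have h1 : (r : WithTop ℝ≥0) < hittingAfter X (Ioo a b)ᶜ 0 ω :=
      (WithTop.coe_lt_coe.2 hr).trans_le ht
    exact Ioo_subset_Icc_self (not_not.1 (notMem_of_lt_hittingAfter h1 zero_le))
  have hcl := closure_minimal hsub (isClosed_Icc.preimage hX)
  rw [closure_Iio' ⟨0, pos_of_ne_zero hne⟩] at hcl
  exact hcl (mem_Iic.2 le_rfl)

variable {Ω : Type*} {m : MeasurableSpace Ω} {𝓕 : Filtration ℝ≥0 m} {P : Measure Ω}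
  {B : ℝ≥0 → Ω → ℝ}

/-- The exponential martingale leaves every interval `(a, b)` with `0 < a`. -/
lemma IsStandardBM.ae_exists_expProcess_le [IsProbabilityMeasure P] (hB : IsStandardBM 𝓕 P B)
    {c θ a : ℝ} (hc : 0 < c) (hθ : θ ≠ 0) (ha : 0 < a) :
    ∀ᵐ ω ∂P, ∃ t, expProcess c θ B t ω ≤ a := by
  rw [ae_iff]
  set N : Set Ω := {ω | ¬ ∃ t, expProcess c θ B t ω ≤ a} with hN
  -- On `N`, θ B_n > log(a/c) + θ² n/2, so the martingale with parameter θ/2 is at least `ε n` at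
  -- time n. It has mean 1, so Markov gives `ε n * P N ≤ 1`, while `ε n` tends to infinity.
  let ε : ℕ → ℝ≥0∞ := fun n => ENNReal.ofReal
    (Real.exp (Real.log (a / c) / 2 + θ ^ 2 / 8 * n))
  have hbound : ∀ n, ε n * P N ≤ 1 := by
    intro n
    have hm : Measurable fun ω => ENNReal.ofReal (expProcess 1 (θ / 2) B (n : ℝ≥0) ω) :=
      (hB.measurable_expProcess_comp 1 (θ / 2) measurable_const).ennreal_ofReal
    have h1 := mul_meas_ge_le_lintegral (μ := P) hm (ε n)
    rw [hB.lintegral_expProcess zero_le_one, ENNReal.ofReal_one] at h1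
    refine le_trans (mul_le_mul_right (measure_mono fun ω hω => ?_) _) h1
    simp only [hN, mem_ofPred_eq, not_exists, not_le] at hω
    have h2 := hω n
    refine ENNReal.ofReal_le_ofReal ?_
    rw [expProcess, one_mul, Real.exp_le_exp]
    rw [expProcess, ← div_lt_iff₀' hc, ← Real.log_lt_iff_lt_exp (by positivity)] at h2
    simp only [NNReal.coe_natCast] at h2 ⊢
    linarith
  have hε : Tendsto ε atTop (𝓝 ∞) := by
    refine ENNReal.tendsto_ofReal_atTop.comp (Real.tendsto_exp_atTop.comp ?_)
    refine tendsto_atTop_add_const_left _ _ ?_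
    exact tendsto_natCast_atTop_atTop.const_mul_atTop (by positivity)
  by_contra hne
  have h3 := ENNReal.Tendsto.mul_const (b := P N) hε (Or.inl ENNReal.top_ne_zero)
  rw [ENNReal.top_mul hne] at h3
  exact absurd (le_of_tendsto' h3 hbound) (by simp)

variable {s θ a b : ℝ}

lemma IsStandardBM.hittingAfter_mem_admissibleTimes [IsProbabilityMeasure P]
    (hB : IsStandardBM 𝓕 P B) (hs : 0 < s) (hθ : θ ≠ 0) (ha : 0 < a) :
    hittingAfter (expProcess s θ B) (Ioo a b)ᶜ 0 ∈ admissibleTimes 𝓕 P := by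
  refine ⟨isStoppingTime_hittingAfter_isClosed isOpen_Ioo.isClosed_compl
    (hB.continuous_expProcess s θ) (hB.adapted_expProcess s θ), ?_⟩
  filter_upwards [hB.ae_exists_expProcess_le hs hθ ha] with ω hω
  obtain ⟨t, ht⟩ := hω
  refine ne_top_of_le_ne_top WithTop.coe_ne_top (hittingAfter_le_of_mem (i := t) zero_le ?_)
  exact fun h => absurd h.1 (not_lt.2 ht)

/-- At the exit time the path lies outside (a, b) but still in [a, b], which leaves the endpoints.
-/
lemma IsStandardBM.stoppedValue_exitTime_eq_or [IsProbabilityMeasure P]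
    (hB : IsStandardBM 𝓕 P B) (hs : 0 < s) (hθ : θ ≠ 0) (ha : 0 < a) (has : a ≤ s) (hsb : s ≤ b) :
    ∀ᵐ ω ∂P, stoppedValue (expProcess s θ B)
        (hittingAfter (expProcess s θ B) (Ioo a b)ᶜ 0) ω = a ∨
      stoppedValue (expProcess s θ B)
        (hittingAfter (expProcess s θ B) (Ioo a b)ᶜ 0) ω = b := by
  filter_upwards [hB.expProcess_zero s θ,
    (hB.hittingAfter_mem_admissibleTimes (b := b) hs hθ ha).2] with ω h0 hω
  have h1 := mem_of_hittingAfter_ne_top isOpen_Ioo.isClosed_compl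
    (hB.continuous_expProcess s θ) hω
  have h2 := mem_Icc_of_le_hittingAfter (hB.continuous_expProcess s θ ω)
    (by rw [h0]; exact ⟨has, hsb⟩) (coe_untopA hω).le
  rw [stoppedValue]
  by_contra hne
  push Not at hne
  exact h1 ⟨lt_of_le_of_ne h2.1 hne.1.symm, lt_of_le_of_ne h2.2 hne.2⟩

lemma IsStandardBM.measurable_stoppedValue_expProcess (hB : IsStandardBM 𝓕 P B) (c θ : ℝ)
    {τ : Ω → WithTop ℝ≥0} (hτ : IsStoppingTime 𝓕 τ) :
    Measurable (stoppedValue (expProcess c θ B) τ) :=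
  hB.measurable_expProcess_comp c θ hτ.measurable'.untopA

/-- One inequality is the supermartingale bound. The other is bounded optional stopping at τ ∧ n,
passed to the limit with the dominating constant b. -/
lemma IsStandardBM.lintegral_stoppedValue_exitTime [IsProbabilityMeasure P]
    (hB : IsStandardBM 𝓕 P B) (hs : 0 < s) (hθ : θ ≠ 0) (ha : 0 < a) (has : a ≤ s) (hsb : s ≤ b) :
    ∫⁻ ω, ENNReal.ofReal (stoppedValue (expProcess s θ B)
        (hittingAfter (expProcess s θ B) (Ioo a b)ᶜ 0) ω) ∂P = ENNReal.ofReal s := by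
  set τ := hittingAfter (expProcess s θ B) (Ioo a b)ᶜ 0 with hτdef
  have hτ : τ ∈ admissibleTimes 𝓕 P := hB.hittingAfter_mem_admissibleTimes hs hθ ha
  refine le_antisymm (hB.lintegral_stoppedValue_expProcess_le hs.le θ hτ) ?_
  have hlim : Tendsto (fun n : ℕ => ∫⁻ ω, ENNReal.ofReal
      (expProcess s θ B (truncTime τ n ω) ω) ∂P) atTop
      (𝓝 (∫⁻ ω, ENNReal.ofReal (stoppedValue (expProcess s θ B) τ ω) ∂P)) := by
    refine tendsto_lintegral_of_dominated_convergence (fun _ => ENNReal.ofReal b) (fun n =>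
      (hB.measurable_expProcess_comp s θ (measurable_truncTime hτ.1 n)).ennreal_ofReal)
      (fun n => ?_) (by simp) ?_
    · filter_upwards [hB.expProcess_zero s θ] with ω h0
      refine ENNReal.ofReal_le_ofReal (mem_Icc_of_le_hittingAfter (a := a) (b := b)
        (hB.continuous_expProcess s θ ω) (by rw [h0]; exact ⟨has, hsb⟩) ?_).2
      rw [coe_truncTime]
      exact min_le_left _ _
    · filter_upwards [hτ.2] with ω hω
      refine tendsto_const_nhds.congr' ?_
      obtain ⟨N, hN⟩ := exists_nat_ge (τ ω).untopA
      filter_upwards [eventually_ge_atTop N] with n hn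
      rw [truncTime_eq_of_le hω (hN.trans (by exact_mod_cast hn)), stoppedValue]
  exact ge_of_tendsto' hlim fun n => hB.le_lintegral_expProcess_of_bounded hs.le θ
    (measurableSet_truncTime_le hτ.1 n) (truncTime_le τ n)

end ExitTime

/-! ### Random variables with two values -/

section TwoPoint

variable {Ω : Type*} {m : MeasurableSpace Ω} {P : Measure Ω} [IsProbabilityMeasure P]

/-- Taking g = id reads the weight of b off the mean; taking g an indicator gives the survival
function. When a = b the correction term vanishes. -/
lemma integral_comp_of_two_point {X : Ω → ℝ} (hX : Measurable X) {a b : ℝ}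
    (hab : ∀ᵐ ω ∂P, X ω = a ∨ X ω = b) (g : ℝ → ℝ) :
    ∫ ω, g (X ω) ∂P = g a + P.real {ω | X ω = b} * (g b - g a) := by
  have hE : MeasurableSet {ω | X ω = b} := hX (measurableSet_singleton b)
  have h : (fun ω => g (X ω)) =ᵐ[P]
      fun ω => g a + {ω | X ω = b}.indicator (fun _ => g b - g a) ω := by
    filter_upwards [hab] with ω hω
    by_cases hb : X ω = b
    · simp [hb]
    · rw [indicator_of_notMem (by exact hb), add_zero, hω.resolve_right hb]
  rw [integral_congr_ae h, integral_add (integrable_const _)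
    ((integrable_const _).indicator hE), integral_indicator_const _ hE]
  simp

/-- The Choquet integral of a random variable taking two values and with mean `s`. -/
lemma choquet_eq_thresholdValue {w u : ℝ → ℝ} (hw0 : w 0 = 0) (hw1 : w 1 = 1) (hwm : Monotone w)
    (hum : Monotone u) (hu0 : u 0 = 0) {X : Ω → ℝ} (hX : Measurable X) (hpos : ∀ ω, 0 < X ω)
    {s a b : ℝ} (ha : 0 < a) (has : a ≤ s) (hsb : s ≤ b)
    (hmean : ∫⁻ ω, ENNReal.ofReal (X ω) ∂P = ENNReal.ofReal s)
    (hab : ∀ᵐ ω ∂P, X ω = a ∨ X ω = b) :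
    ∫⁻ t in Ioi (0 : ℝ), ENNReal.ofReal (w (P.real {ω | t < u (X ω)})) =
      ENNReal.ofReal (thresholdValue w u s (a, b)) := by
  have hmean' : ∫ ω, X ω ∂P = s := by
    rw [integral_eq_lintegral_of_nonneg_ae (ae_of_all _ fun ω => (hpos ω).le)
      hX.aestronglyMeasurable, hmean, ENNReal.toReal_ofReal (ha.le.trans has)]
  have h1 := integral_comp_of_two_point hX hab id
  simp only [id, hmean'] at h1
  have hp0 : 0 ≤ (s - a) / (b - a) := div_nonneg (by linarith) (by linarith)
  have hp1 : (s - a) / (b - a) ≤ 1 := div_le_one_of_le₀ (by linarith) (by linarith)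
  have hlaw : ∀ t, P.real {ω | t < u (X ω)} =
      (1 - (s - a) / (b - a)) * (Iio (u a)).indicator 1 t +
        (s - a) / (b - a) * (Iio (u b)).indicator 1 t := by
    intro t
    have hset : MeasurableSet {ω | t < u (X ω)} :=
      measurableSet_lt measurable_const (hum.measurable.comp hX)
    have h2 := integral_comp_of_two_point hX hab ({x | t < u x}.indicator 1)
    have h3 : ∫ ω, {x | t < u x}.indicator (1 : ℝ → ℝ) (X ω) ∂P = P.real {ω | t < u (X ω)} :=
      integral_indicator_one hset
    have h4 : ∀ x, {x | t < u x}.indicator (1 : ℝ → ℝ) x = (Iio (u x)).indicator 1 t := by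
      intro x
      by_cases h : t < u x <;> simp [h]
    rw [← h3, h2, h4, h4]
    -- When a = b the mean does not determine the weight, but both sides reduce to the same
    -- indicator.
    rcases eq_or_lt_of_le (has.trans hsb) with rfl | hlt
    · simp
    · have h5 : P.real {ω | X ω = b} = (s - a) / (b - a) := by
        rw [eq_div_iff (by linarith)]
        linarith
      rw [h5]
      ring
  simp_rw [hlaw]
  exact lintegral_distortion_two_point hw0 hw1 (hw0 ▸ hwm hp0) (hw1 ▸ hwm hp1)
    (hu0 ▸ hum ha.le) (hum (has.trans hsb))

end TwoPoint

/-! ### Optimality of threshold times -/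

section Optimality

variable {Ω : Type*} {m : MeasurableSpace Ω} {𝓕 : Filtration ℝ≥0 m} {P : Measure Ω}
  [IsProbabilityMeasure P] {B : ℝ≥0 → Ω → ℝ}

/-- The choice of β gives β(μ - σ²/2) = -(βσ)²/2, exactly the compensator of βσB. -/
lemma scaledProcess_eq_expProcess {p₀ μ σ : ℝ} (hp₀ : 0 < p₀) (hσ : 0 < σ) :
    scaledProcess p₀ μ σ B =
      expProcess (p₀ ^ scaleExponent μ σ) (scaleExponent μ σ * σ) B := by
  funext t ω
  rw [scaledProcess, geometricBM, expProcess, Real.mul_rpow hp₀.le (Real.exp_pos _).le,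
    ← Real.exp_mul]
  congr 2
  rw [scaleExponent]
  field_simp
  ring

lemma thresholdTime_mem_admissibleTimes (hB : IsStandardBM 𝓕 P B) {s θ a b : ℝ}
    (hs : 0 < s) (hθ : θ ≠ 0) (ha : 0 < a) :
    thresholdTime (expProcess s θ B) a b ∈ admissibleTimes 𝓕 P := by
  rw [thresholdTime]
  split_ifs
  · exact hB.hittingAfter_mem_admissibleTimes hs hθ ha
  · exact ⟨isStoppingTime_const 𝓕 0, ae_of_all _ fun ω => WithTop.coe_ne_top⟩

lemma distortedPayoff_thresholdTime (hB : IsStandardBM 𝓕 P B) {w u : ℝ → ℝ} (hw0 : w 0 = 0)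
    (hw1 : w 1 = 1) (hwm : Monotone w) (hum : Monotone u) (hu0 : u 0 = 0) {s θ a b : ℝ}
    (hθ : θ ≠ 0) (hab : (a, b) ∈ thresholdPairs s) :
    distortedPayoff P w u (expProcess s θ B) (thresholdTime (expProcess s θ B) a b) =
      ENNReal.ofReal (thresholdValue w u s (a, b)) := by
  obtain ⟨ha, has, hsb⟩ := hab
  simp only at ha has hsb
  have hs : 0 < s := ha.trans_le has
  have hadm := thresholdTime_mem_admissibleTimes (b := b) hB hs hθ ha
  refine choquet_eq_thresholdValue hw0 hw1 hwm hum hu0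
    (hB.measurable_stoppedValue_expProcess s θ hadm.1) (fun ω => expProcess_pos hs θ _ ω)
    ha has hsb ?_ ?_
  · rw [thresholdTime]
    split_ifs
    · exact hB.lintegral_stoppedValue_exitTime hs hθ ha has hsb
    · exact hB.lintegral_expProcess hs.le θ 0
  · rw [thresholdTime]
    split_ifs with h
    · exact hB.stoppedValue_exitTime_eq_or hs hθ ha has hsb
    -- Here b ≤ a, which together with a ≤ s ≤ b forces a = s = b.
    · filter_upwards [hB.expProcess_zero s θ] with ω hω
      left
      change expProcess s θ B 0 ω = a
      linarith

lemma distortedPayoff_le (hB : IsStandardBM 𝓕 P B) {w u : ℝ → ℝ} (hw0 : w 0 = 0)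
    (hw1 : w 1 = 1) (hwm : Monotone w) (hconv : ConvexOn ℝ (Icc 0 1) w)
    (hwc : ContinuousOn w (Icc 0 1)) (hum : Monotone u) (hu0 : u 0 = 0) {s θ : ℝ} (hs : 0 < s)
    {τ : Ω → WithTop ℝ≥0} (hτ : τ ∈ admissibleTimes 𝓕 P) :
    distortedPayoff P w u (expProcess s θ B) τ ≤
      ⨆ q ∈ thresholdPairs s, ENNReal.ofReal (thresholdValue w u s q) :=
  choquet_le_of_lintegral_le hw0 hw1 hwm hconv hwc hum hu0 P
    (hB.measurable_stoppedValue_expProcess s θ hτ.1) (fun ω => expProcess_pos hs θ _ ω) hs.le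
    (hB.lintegral_stoppedValue_expProcess_le hs.le θ hτ)
    fun q hq => le_iSup₂ (f := fun q _ => ENNReal.ofReal (thresholdValue w u s q)) q hq

/-- The threshold problem for functions that are monotone on the whole line. -/
lemma iSup_distortedPayoff_eq_and_isOptimalStopping (hB : IsStandardBM 𝓕 P B) {w u : ℝ → ℝ}
    (hw0 : w 0 = 0) (hw1 : w 1 = 1) (hwm : Monotone w) (hconv : ConvexOn ℝ (Icc 0 1) w)
    (hwc : ContinuousOn w (Icc 0 1)) (hum : Monotone u) (hu0 : u 0 = 0) {s θ : ℝ} (hs : 0 < s)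
    (hθ : θ ≠ 0) :
    (⨆ τ ∈ admissibleTimes 𝓕 P, distortedPayoff P w u (expProcess s θ B) τ)
        = ⨆ q ∈ thresholdPairs s, ENNReal.ofReal (thresholdValue w u s q) ∧
      ∀ a b : ℝ, (a, b) ∈ thresholdPairs s →
        IsMaxOn (thresholdValue w u s) (thresholdPairs s) (a, b) →
        IsOptimalStopping 𝓕 P w u (expProcess s θ B) (thresholdTime (expProcess s θ B) a b) := by
  refine ⟨le_antisymm (iSup₂_le fun τ hτ =>
    distortedPayoff_le hB hw0 hw1 hwm hconv hwc hum hu0 hs hτ) (iSup₂_le fun q hq => ?_), ?_⟩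
  · rw [← distortedPayoff_thresholdTime hB hw0 hw1 hwm hum hu0 hθ (a := q.1) (b := q.2) hq]
    exact le_iSup₂ (f := fun τ _ => distortedPayoff P w u (expProcess s θ B) τ) _
      (thresholdTime_mem_admissibleTimes hB hs hθ hq.1)
  · intro a b hab hmax
    refine ⟨thresholdTime_mem_admissibleTimes hB hs hθ hab.1, fun τ hτ => ?_⟩
    rw [mem_ofPred_eq, distortedPayoff_thresholdTime hB hw0 hw1 hwm hum hu0 hθ hab]
    exact (distortedPayoff_le hB hw0 hw1 hwm hconv hwc hum hu0 hs hτ).trans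
      (iSup₂_le fun q hq => ENNReal.ofReal_le_ofReal (hmax hq))

/-- Probabilities lie in [0, 1] and the process is nonnegative, so u and w may be replaced by
globally monotone extensions. -/
lemma distortedPayoff_congr {w w' u u' : ℝ → ℝ} (hw : EqOn w w' (Icc 0 1))
    (hu : EqOn u u' (Ici 0)) {X : ℝ≥0 → Ω → ℝ} (hX : ∀ t ω, 0 ≤ X t ω) :
    distortedPayoff P w u X = distortedPayoff P w' u' X := by
  funext τ
  refine lintegral_congr fun t => ?_
  have h : {ω | t < u (stoppedValue X τ ω)} = {ω | t < u' (stoppedValue X τ ω)} := by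
    ext ω
    rw [mem_ofPred_eq, mem_ofPred_eq, hu (show stoppedValue X τ ω ∈ Ici 0 from hX _ ω)]
  rw [h, hw ⟨measureReal_nonneg, measureReal_le_one⟩]

lemma thresholdValue_congr {w w' u u' : ℝ → ℝ} (hw : EqOn w w' (Icc 0 1))
    (hu : EqOn u u' (Ici 0)) (s : ℝ) :
    EqOn (thresholdValue w u s) (thresholdValue w' u' s) (thresholdPairs s) := by
  rintro q ⟨h0, h1, h2⟩
  rw [thresholdValue, thresholdValue, hu (mem_Ici.2 h0.le), hu (mem_Ici.2 (by linarith)),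
    hw (show (s - q.1) / (q.2 - q.1) ∈ Icc 0 1 from
      ⟨upperWeight_nonneg h1 h2, upperWeight_le_one h1 h2⟩)]

end Optimality

end DistortedStopping

/-! ### Reduction to globally monotone functions -/

theorem theorem4p2 {Ω : Type*} {m : MeasurableSpace Ω} (𝓕 : Filtration ℝ≥0 m)
    (P : Measure Ω) [IsProbabilityMeasure P] (B : ℝ≥0 → Ω → ℝ)
    (hB : DistortedStopping.IsStandardBM 𝓕 P B)
    (p₀ μ σ : ℝ) (hp₀ : 0 < p₀) (hσ : 0 < σ) (hμ : μ ≠ σ ^ 2 / 2)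
    (S : ℝ≥0 → Ω → ℝ) (hS : S = DistortedStopping.scaledProcess p₀ μ σ B)
    (s : ℝ) (hs : s = p₀ ^ DistortedStopping.scaleExponent μ σ)
    (u w : ℝ → ℝ) (hu : DistortedStopping.IsPayoff u) (hw : DistortedStopping.IsDistortion w)
    (hconv : ConvexOn ℝ (Set.Icc 0 1) w) :
    (⨆ τ ∈ DistortedStopping.admissibleTimes 𝓕 P, DistortedStopping.distortedPayoff P w u S τ)
        = ⨆ q ∈ DistortedStopping.thresholdPairs s,
            ENNReal.ofReal (DistortedStopping.thresholdValue w u s q) ∧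
      ∀ a b : ℝ, (a, b) ∈ DistortedStopping.thresholdPairs s →
        IsMaxOn (DistortedStopping.thresholdValue w u s) (DistortedStopping.thresholdPairs s)
          (a, b) →
        DistortedStopping.IsOptimalStopping 𝓕 P w u S (DistortedStopping.thresholdTime S a b) := by
  open DistortedStopping Set in
  have hs0 : 0 < s := hs ▸ Real.rpow_pos_of_pos hp₀ _
  have hθ : scaleExponent μ σ * σ ≠ 0 := by
    refine mul_ne_zero (div_ne_zero (fun h => hμ ?_) (by positivity)) hσ.ne'
    linarith
  have hS' : S = expProcess s (scaleExponent μ σ * σ) B := by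
    rw [hS, hs, scaledProcess_eq_expProcess hp₀ hσ]
  -- Constant extensions beyond [0, ∞) and [0, 1] make both functions monotone, hence Borel, on the
  -- whole line.
  let u' : ℝ → ℝ := fun x => u (max x 0)
  let w' : ℝ → ℝ := fun x => w (max 0 (min 1 x))
  have huu : EqOn u u' (Ici 0) := fun x hx => by simp only [u', max_eq_left (mem_Ici.1 hx)]
  have hww : EqOn w w' (Icc 0 1) := fun x hx => by
    simp only [w', min_eq_right hx.2, max_eq_right hx.1]
  have hum : Monotone u' := fun x y hxy =>
    hu.monotoneOn (mem_Ici.2 (le_max_right _ _)) (mem_Ici.2 (le_max_right _ _))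
      (max_le_max_right 0 hxy)
  have hmem : ∀ x : ℝ, max 0 (min 1 x) ∈ Icc (0 : ℝ) 1 := fun x =>
    ⟨le_max_left _ _, max_le zero_le_one (min_le_left _ _)⟩
  have hwm : Monotone w' := fun x y hxy =>
    hw.strictMonoOn.monotoneOn (hmem x) (hmem y) (max_le_max_left 0 (min_le_min_left 1 hxy))
  -- Jensen's inequality is applied on the closed interval, where convexity alone does not give
  -- continuity at the endpoints.
  have hwc : ContinuousOn w (Icc 0 1) := by
    have h := hw.absolutelyContinuous.continuousOn
    rwa [uIcc_of_le zero_le_one] at h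
  obtain ⟨h1, h2⟩ := iSup_distortedPayoff_eq_and_isOptimalStopping hB
    ((hww (left_mem_Icc.2 zero_le_one)).symm.trans hw.zero)
    ((hww (right_mem_Icc.2 zero_le_one)).symm.trans hw.one) hwm (hconv.congr hww)
    (hwc.congr hww.symm) hum ((huu (mem_Ici.2 le_rfl)).symm.trans hu.zero) hs0 hθ
  rw [← hS', ← distortedPayoff_congr hww huu
    (fun t ω => by rw [hS']; exact (expProcess_pos hs0 _ t ω).le)] at h1
  refine ⟨h1.trans (iSup_congr fun q => iSup_congr fun hq => by rw [thresholdValue_congr hww huu s hq]), ?_⟩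
  intro a b hab hmax
  have hmax' : IsMaxOn (thresholdValue w' u' s) (thresholdPairs s) (a, b) := fun q hq => by
    have := hmax hq
    simp only [mem_ofPred_eq] at this ⊢
    rwa [← thresholdValue_congr hww huu s hq, ← thresholdValue_congr hww huu s hab]
  have h3 := h2 a b hab hmax'
  rw [← hS', IsOptimalStopping, ← distortedPayoff_congr hww huu
    (fun t ω => by rw [hS']; exact (expProcess_pos hs0 _ t ω).le)] at h3
  exact h3
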